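/- Let $X_n$, $n\ge 1$, be real random variables on a probability space and $S_n=X_1+\cdots+X_n$. The sequence is called L-weakly dependent if there are coefficients $\gamma_k\ge 0$, $k\ge 1$, with $\sum_{k\ge1}\gamma_k<\infty$, such that for all disjoint finite sets $I,J\subset\{1,2,\dots\}$ and all Lipschitz functions $f:\mathbb{R}^I\to\mathbb{R}$, $g:\mathbb{R}^J\to\mathbb{R}$, $$\bigl|\mathrm{Cov}\bigl(f(X_i,i\in I),\,g(X_j,j\in J)\bigr)\bigr|\le \|f\|\,\|g\|\sum_{i\in I}\sum_{j\in J}\gamma_{|j-i|},\qquad \|f\|=\sup_{x\ne y}\frac{|f(x)-f(y)|}{\sum_{i}|x_i-y_i|}.$$ **Theorem (central limit theorem).** Let $X_n$, $n\ge1$, be centered, square integrable, strictly stationary and L-weakly dependent. Then the limit $\sigma^2=\lim_{n\to\infty}\frac1n\,\mathbb{E}\,S_n^2$ exists in $[0,\infty)$, and $\frac{1}{\sqrt n}S_n$ converges in distribution to $N(0,\sigma^2)$, the centered normal distribution with variance $\sigma^2$ (where $N(0,0)$ is the point mass at $0$). -/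

import Mathlib

open MeasureTheory ProbabilityTheory Filter
open scoped Topology NNReal

noncomputable section

/-- `f` is a Lipschitz function of finitely many real variables
(with respect to the `ℓ¹` norm `∑ i, |x i|`, hence with respect to any norm). -/
def IsLip {ι : Type*} [Fintype ι] (f : (ι → ℝ) → ℝ) : Prop :=
  ∃ K : ℝ, ∀ x y : ι → ℝ, |f x - f y| ≤ K * ∑ i, |x i - y i|

/-- The Lipschitz norm `‖f‖ = sup_{x ≠ y} |f x - f y| / |x - y|`, where `|x - y| = ∑ i, |x i - y i|`.
With this norm on the argument, `x ↦ cos (∑ i, t i * x i)` has Lipschitz norm `max_i |t i|`.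
(The supremum over the empty set, which occurs when there is no variable, is `0`.) -/
def lipNorm {ι : Type*} [Fintype ι] (f : (ι → ℝ) → ℝ) : ℝ :=
  sSup {r : ℝ | ∃ x y : ι → ℝ, x ≠ y ∧ r = |f x - f y| / ∑ i, |x i - y i|}

/-- L-weak dependence of a sequence of real random variables: there is one sequence of nonnegative
coefficients with convergent sum which controls the covariances of Lipschitz functions of any two
disjoint finite subfamilies. As `I` and `J` are disjoint, only the `γ k` with `k ≥ 1` occur
in the inequality. -/
def IsLWeaklyDependent {Ω : Type*} [MeasurableSpace Ω] (μ : Measure Ω) (X : ℕ → Ω → ℝ) : Prop :=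
  ∃ γ : ℕ → ℝ, (∀ k, 0 ≤ γ k) ∧ Summable γ ∧
    ∀ I J : Finset ℕ, Disjoint I J →
      ∀ (f : (I → ℝ) → ℝ) (g : (J → ℝ) → ℝ), IsLip f → IsLip g →
        |cov[fun ω ↦ f (fun i ↦ X i ω), fun ω ↦ g (fun j ↦ X j ω); μ]| ≤
          lipNorm f * lipNorm g * ∑ i ∈ I, ∑ j ∈ J, γ ((j : ℤ) - (i : ℤ)).natAbs

/-- Strict stationarity: the finite-dimensional distributions are invariant under time shifts. -/
def IsStrictlyStationary {Ω : Type*} [MeasurableSpace Ω] (μ : Measure Ω) (X : ℕ → Ω → ℝ) : Prop :=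
  ∀ (h : ℕ) (I : Finset ℕ),
    IdentDistrib (fun ω (i : I) ↦ X (i + h) ω) (fun ω (i : I) ↦ X i ω) μ μ

/-- `partialSum X n` is the sum of the first `n` terms of the sequence,
which is indexed from `0`: `X 0` is the first term. -/
def partialSum {Ω : Type*} (X : ℕ → Ω → ℝ) (n : ℕ) (ω : Ω) : ℝ :=
  ∑ k ∈ Finset.range n, X k ω

end

/-!
Bernstein's blocks, without gaps. For `m` fixed, cut `S n` into `n / m` blocks of length `m` and a
remainder of fewer than `m` terms, which is negligible at scale `√n`. Applying weak dependence to
`cos (s * ·)` and `sin (s * ·)`, whose Lipschitz constant is `|s|`, shows that splitting off one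
block changes the characteristic function at `s` by at most `4 s² ∑ j < m, ∑ k > j, γ k`. At
`s = t / √n` the `n / m` splittings thus cost at most `4 t² (1/m) ∑ j < m, ∑ k > j, γ k`, a Cesàro
mean of the tails of a convergent series. For independent blocks the central limit theorem gives the
limit `exp (-t² Var (S m) / (2 m))`; then let `m → ∞`.
-/

section Limits

theorem tendsto_of_eventually_dist_lt {α ι κ : Type*} [PseudoMetricSpace α] {p : Filter ι}
    {q : Filter κ} [p.NeBot] {a : κ → α} {b : ι → κ → α} {c : ι → α} {l : α}
    (hab : ∀ ε > 0, ∀ᶠ i in p, ∀ᶠ k in q, dist (a k) (b i k) < ε)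
    (hb : ∀ᶠ i in p, Tendsto (b i) q (𝓝 (c i))) (hc : Tendsto c p (𝓝 l)) :
    Tendsto a q (𝓝 l) := by
  refine Metric.tendsto_nhds.2 fun ε hε ↦ ?_
  obtain ⟨i, habi, hbi, hci⟩ :=
    ((hab (ε / 3) (by positivity)).and
      (hb.and (Metric.tendsto_nhds.1 hc (ε / 3) (by positivity)))).exists
  filter_upwards [habi, Metric.tendsto_nhds.1 hbi (ε / 3) (by positivity)] with k hk hbk
  linarith [dist_triangle4 (a k) (b i k) (c i) l]

theorem tendsto_one_add_pow_exp_of_tendsto_mul {ι : Type*} {l : Filter ι} {k : ι → ℕ} {g : ι → ℂ}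
    {z : ℂ} (hg : Tendsto g l (𝓝 0)) (hkg : Tendsto (fun i ↦ k i * g i) l (𝓝 z)) :
    Tendsto (fun i ↦ (1 + g i) ^ k i) l (𝓝 (Complex.exp z)) := by
  have hlog : Tendsto (fun i ↦ k i * Complex.log (1 + g i)) l (𝓝 z) := by
    have hsub : (fun i ↦ k i * (Complex.log (1 + g i) - g i)) =O[l] fun i ↦ k i * g i * g i := by
      simpa only [Function.comp_def, mul_assoc, sq] using
        (Asymptotics.isBigO_refl (fun i ↦ (k i : ℂ)) l).mul
          (Complex.log_sub_self_isBigO.comp_tendsto hg)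
    have hzero : Tendsto (fun i ↦ k i * g i * g i) l (𝓝 0) := by simpa using hkg.mul hg
    simpa [mul_sub] using (hsub.trans_tendsto hzero).add hkg
  refine ((Complex.continuous_exp.tendsto z).comp hlog).congr' ?_
  filter_upwards [hg.eventually_ne (show (0 : ℂ) ≠ -1 by simp)] with i hi
  have hne : 1 + g i ≠ 0 := fun h ↦ hi (eq_neg_of_add_eq_zero_right h)
  rw [Function.comp_apply, Complex.exp_nat_mul, Complex.exp_log hne]

theorem norm_sub_pow_le_of_norm_add_sub_mul_le {R : Type*} [SeminormedRing R] {a : ℕ → R}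
    {m : ℕ} {C : ℝ} (h0 : a 0 = 1) (hm : ‖a m‖ ≤ 1)
    (h : ∀ N, ‖a (N + m) - a N * a m‖ ≤ C) (k : ℕ) :
    ‖a (k * m) - a m ^ k‖ ≤ k * C := by
  induction k with
  | zero => simp [h0]
  | succ k ih =>
    have hk : ‖(a (k * m) - a m ^ k) * a m‖ ≤ k * C :=
      (norm_mul_le _ _).trans ((mul_le_of_le_one_right (norm_nonneg _) hm).trans ih)
    calc ‖a ((k + 1) * m) - a m ^ (k + 1)‖
        = ‖(a (k * m + m) - a (k * m) * a m) + (a (k * m) - a m ^ k) * a m‖ := by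
          rw [add_one_mul, pow_succ, sub_mul, sub_add_sub_cancel]
      _ ≤ C + k * C := norm_add_le_of_le (h _) hk
      _ = (k + 1 : ℕ) * C := by push_cast; ring

theorem tendsto_natCast_div_natCast_div (m : ℕ) :
    Tendsto (fun n : ℕ ↦ ((n / m : ℕ) : ℝ) / n) atTop (𝓝 (1 / m)) := by
  refine ((tendsto_nat_floor_mul_div_atTop (R := ℝ) (a := 1 / m) (by positivity)).comp
    tendsto_natCast_atTop_atTop).congr fun n ↦ ?_
  rw [Function.comp_apply, one_div_mul_eq_div, Nat.floor_div_eq_div]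

theorem tendsto_div_sqrt_natCast (t : ℝ) : Tendsto (fun n : ℕ ↦ t / √n) atTop (𝓝 0) :=
  tendsto_const_nhds.div_atTop (Real.tendsto_sqrt_atTop.comp tendsto_natCast_atTop_atTop)

theorem natCast_div_mul_div_sqrt_sq_mul_le {c : ℝ} (hc : 0 ≤ c) (t : ℝ) (n m : ℕ) :
    (n / m : ℕ) * ((t / √n) ^ 2 * c) ≤ t ^ 2 * (c / m) := by
  have hratio : ((n / m : ℕ) : ℝ) / n ≤ 1 / m := by
    refine div_le_of_le_mul₀ n.cast_nonneg (by positivity) ?_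
    rw [one_div_mul_eq_div]
    exact Nat.cast_div_le
  calc (n / m : ℕ) * ((t / √n) ^ 2 * c) = t ^ 2 * c * ((n / m : ℕ) / n) := by
        rw [div_pow, Real.sq_sqrt n.cast_nonneg]
        ring
    _ ≤ t ^ 2 * c * (1 / m) := by gcongr
    _ = t ^ 2 * (c / m) := by ring

end Limits

section CharacteristicFunction

variable {Ω : Type*} [MeasurableSpace Ω] {μ : Measure Ω} {U V Y : Ω → ℝ}

theorem charFun_map_real (hU : AEMeasurable U μ) (t : ℝ) :
    charFun (μ.map U) t = ∫ ω, Complex.exp ((t * U ω : ℝ) * Complex.I) ∂μ := by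
  rw [charFun_apply_real, integral_map hU (by fun_prop)]
  simp only [Complex.ofReal_mul]

section IsFiniteMeasure

variable [IsFiniteMeasure μ]

theorem norm_charFun_map_sub_charFun_map_le (hU : AEMeasurable U μ)
    (hV : AEMeasurable V μ) (hUV : Integrable (fun ω ↦ U ω - V ω) μ) (t : ℝ) :
    ‖charFun (μ.map U) t - charFun (μ.map V) t‖ ≤ |t| * ∫ ω, |U ω - V ω| ∂μ := by
  have hint {W : Ω → ℝ} (hW : AEMeasurable W μ) :
      Integrable (fun ω ↦ Complex.exp ((t * W ω : ℝ) * Complex.I)) μ :=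
    .of_bound (by fun_prop) 1 (.of_forall fun ω ↦ (Complex.norm_exp_ofReal_mul_I _).le)
  have hexp (a b : ℝ) :
      ‖Complex.exp (a * Complex.I) - Complex.exp (b * Complex.I)‖ ≤ |a - b| := by
    simpa [circleMap, dist_eq_norm] using (lipschitzWith_circleMap 0 1).dist_le_mul a b
  rw [charFun_map_real hU, charFun_map_real hV, ← integral_sub (hint hU) (hint hV),
    ← integral_const_mul]
  refine norm_integral_le_of_norm_le (hUV.abs.const_mul |t|) (.of_forall fun ω ↦ ?_)
  exact (hexp _ _).trans_eq (by rw [← mul_sub, abs_mul])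

theorem memLp_cos_mul (hU : AEMeasurable U μ) (t : ℝ) (p : ENNReal) :
    MemLp (fun ω ↦ Real.cos (t * U ω)) p μ :=
  .of_bound (by fun_prop) 1 (.of_forall fun _ ↦ Real.abs_cos_le_one _)

theorem memLp_sin_mul (hU : AEMeasurable U μ) (t : ℝ) (p : ENNReal) :
    MemLp (fun ω ↦ Real.sin (t * U ω)) p μ :=
  .of_bound (by fun_prop) 1 (.of_forall fun _ ↦ Real.abs_sin_le_one _)

theorem charFun_map_eq_integral_cos_add_integral_sin (hU : AEMeasurable U μ) (t : ℝ) :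
    charFun (μ.map U) t =
      (∫ ω, Real.cos (t * U ω) ∂μ : ℝ) + (∫ ω, Real.sin (t * U ω) ∂μ : ℝ) * Complex.I := by
  have hcos := (memLp_cos_mul hU t 1).integrable le_rfl
  have hsin := (memLp_sin_mul hU t 1).integrable le_rfl
  rw [charFun_map_real hU, ← integral_complex_ofReal, ← integral_complex_ofReal,
    ← integral_mul_const, ← integral_add hcos.ofReal (hsin.ofReal.mul_const _)]
  simp only [Complex.exp_mul_I, Complex.ofReal_cos, Complex.ofReal_sin]

end IsFiniteMeasure

variable [IsProbabilityMeasure μ]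

theorem charFun_map_add_sub_mul (hU : AEMeasurable U μ) (hV : AEMeasurable V μ) (t : ℝ) :
    charFun (μ.map fun ω ↦ U ω + V ω) t - charFun (μ.map U) t * charFun (μ.map V) t =
      (cov[fun ω ↦ Real.cos (t * U ω), fun ω ↦ Real.cos (t * V ω); μ] -
        cov[fun ω ↦ Real.sin (t * U ω), fun ω ↦ Real.sin (t * V ω); μ] : ℝ) +
      (cov[fun ω ↦ Real.cos (t * U ω), fun ω ↦ Real.sin (t * V ω); μ] +
        cov[fun ω ↦ Real.sin (t * U ω), fun ω ↦ Real.cos (t * V ω); μ] : ℝ) * Complex.I := by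
  have hcU := memLp_cos_mul hU t 2
  have hsU := memLp_sin_mul hU t 2
  have hcV := memLp_cos_mul hV t 2
  have hsV := memLp_sin_mul hV t 2
  have hcos : ∫ ω, Real.cos (t * (U ω + V ω)) ∂μ =
      ∫ ω, Real.cos (t * U ω) * Real.cos (t * V ω) ∂μ -
        ∫ ω, Real.sin (t * U ω) * Real.sin (t * V ω) ∂μ := by
    simp only [mul_add, Real.cos_add]
    exact integral_sub (hcU.integrable_mul hcV) (hsU.integrable_mul hsV)
  have hsin : ∫ ω, Real.sin (t * (U ω + V ω)) ∂μ =
      ∫ ω, Real.sin (t * U ω) * Real.cos (t * V ω) ∂μ +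
        ∫ ω, Real.cos (t * U ω) * Real.sin (t * V ω) ∂μ := by
    simp only [mul_add, Real.sin_add]
    exact integral_add (hsU.integrable_mul hcV) (hcU.integrable_mul hsV)
  rw [charFun_map_eq_integral_cos_add_integral_sin (U := fun ω ↦ U ω + V ω) (hU.add hV),
    charFun_map_eq_integral_cos_add_integral_sin hU,
    charFun_map_eq_integral_cos_add_integral_sin hV, hcos, hsin, covariance_eq_sub hcU hcV,
    covariance_eq_sub hsU hsV, covariance_eq_sub hcU hsV, covariance_eq_sub hsU hcV]
  simp only [Pi.mul_apply]
  push_cast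
  linear_combination (-(∫ ω, Real.sin (t * U ω) ∂μ : ℝ) * (∫ ω, Real.sin (t * V ω) ∂μ : ℝ) : ℂ) *
    Complex.I_sq

theorem isLittleO_charFun_map_sub (hY : MemLp Y 2 μ) (h0 : μ[Y] = 0) :
    (fun t ↦ charFun (μ.map Y) t - (1 - Var[Y; μ] * t ^ 2 / 2)) =o[𝓝 0] fun t ↦ t ^ 2 := by
  have hm := hY.aestronglyMeasurable.aemeasurable
  have : IsProbabilityMeasure (μ.map Y) := Measure.isProbabilityMeasure_map hm
  have hid : MemLp id 2 (μ.map Y) := (memLp_map_measure_iff (by fun_prop) hm).2 hY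
  have htaylor := taylor_isLittleO_univ (x₀ := 0) (contDiff_charFun (n := 2) hid)
  simpa only [taylorWithinEval_charFun_two_zero hm hid, sub_zero, h0, Complex.ofReal_zero,
    zero_mul, add_zero, variance_of_integral_eq_zero hm h0, Pi.pow_apply] using htaylor

theorem tendsto_charFun_map_pow {ι : Type*} {l : Filter ι} (hY : MemLp Y 2 μ) (h0 : μ[Y] = 0)
    {k : ι → ℕ} {s : ι → ℝ} {τ : ℝ} (hs : Tendsto s l (𝓝 0))
    (hks : Tendsto (fun i ↦ k i * s i ^ 2) l (𝓝 τ)) :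
    Tendsto (fun i ↦ charFun (μ.map Y) (s i) ^ k i) l
      (𝓝 (Complex.exp (-(τ * Var[Y; μ] / 2 : ℝ)))) := by
  have : IsProbabilityMeasure (μ.map Y) :=
    Measure.isProbabilityMeasure_map hY.aestronglyMeasurable.aemeasurable
  have hφ : Tendsto (fun i ↦ charFun (μ.map Y) (s i) - 1) l (𝓝 0) := by
    simpa using (((continuous_charFun (μ := μ.map Y)).tendsto 0).comp hs).sub_const 1
  have herror : Tendsto (fun i ↦ k i * (charFun (μ.map Y) (s i) - (1 - Var[Y; μ] * s i ^ 2 / 2)))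
      l (𝓝 0) := by
    have hO := (Asymptotics.isBigO_refl (fun i ↦ (k i : ℝ)) l).smul_isLittleO
      ((isLittleO_charFun_map_sub hY h0).comp_tendsto hs)
    simpa using (Asymptotics.isLittleO_one_iff ℝ).1 (hO.trans_isBigO (hks.isBigO_one ℝ))
  have hmain : Tendsto (fun i ↦ ((-(k i * s i ^ 2 * Var[Y; μ] / 2) : ℝ) : ℂ)) l
      (𝓝 (-(τ * Var[Y; μ] / 2 : ℝ) : ℝ)) :=
    (Complex.continuous_ofReal.tendsto _).comp ((hks.mul_const _).div_const 2).neg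
  have hk : Tendsto (fun i ↦ k i * (charFun (μ.map Y) (s i) - 1)) l
      (𝓝 (-(τ * Var[Y; μ] / 2 : ℝ) : ℝ)) := by
    rw [← zero_add ((_ : ℝ) : ℂ)]
    refine (herror.add hmain).congr fun i ↦ ?_
    push_cast
    ring
  simpa using tendsto_one_add_pow_exp_of_tendsto_mul hφ hk

end CharacteristicFunction

section PartialSum

variable {Ω : Type*}

theorem partialSum_add (X : ℕ → Ω → ℝ) (m r : ℕ) :
    partialSum X (m + r) =
      fun ω ↦ partialSum X m ω + ∑ j ∈ Finset.Ico m (m + r), X j ω :=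
  funext fun _ ↦ (Finset.sum_range_add_sum_Ico _ (Nat.le_add_right m r)).symm

variable [MeasurableSpace Ω] {μ : Measure Ω} {X : ℕ → Ω → ℝ}

theorem memLp_partialSum {p : ENNReal} (hX : ∀ n, MemLp (X n) p μ) (n : ℕ) :
    MemLp (partialSum X n) p μ :=
  memLp_finsetSum _ fun i _ ↦ hX i

theorem aemeasurable_partialSum (hX : ∀ n, AEMeasurable (X n) μ) (n : ℕ) :
    AEMeasurable (partialSum X n) μ :=
  Finset.aemeasurable_fun_sum _ fun i _ ↦ hX i

theorem integral_partialSum_eq_zero (hX : ∀ n, Integrable (X n) μ) (hcent : ∀ n, μ[X n] = 0)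
    (n : ℕ) : μ[partialSum X n] = 0 :=
  (integral_finsetSum _ fun i _ ↦ hX i).trans (Finset.sum_eq_zero fun i _ ↦ hcent i)

theorem norm_charFun_partialSum_add_sub_le [IsFiniteMeasure μ] {M : ℝ}
    (hX : ∀ n, Integrable (X n) μ) (hM : ∀ n, ∫ ω, |X n ω| ∂μ ≤ M) (m r : ℕ) (s : ℝ) :
    ‖charFun (μ.map (partialSum X (m + r))) s - charFun (μ.map (partialSum X m)) s‖ ≤
      |s| * (r * M) := by
  have hmeas := aemeasurable_partialSum fun n ↦ (hX n).aemeasurable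
  have hdiff (ω : Ω) : partialSum X (m + r) ω - partialSum X m ω =
      ∑ j ∈ Finset.Ico m (m + r), X j ω := by
    rw [partialSum_add, add_sub_cancel_left]
  have hint : Integrable (fun ω ↦ partialSum X (m + r) ω - partialSum X m ω) μ := by
    simpa only [hdiff] using integrable_finsetSum _ fun j _ ↦ hX j
  refine (norm_charFun_map_sub_charFun_map_le (hmeas _) (hmeas _) hint s).trans ?_
  gcongr
  calc ∫ ω, |partialSum X (m + r) ω - partialSum X m ω| ∂μ
      ≤ ∫ ω, ∑ j ∈ Finset.Ico m (m + r), |X j ω| ∂μ := by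
        refine integral_mono hint.abs (integrable_finsetSum _ fun j _ ↦ (hX j).abs) fun ω ↦ ?_
        simpa only [hdiff] using Finset.abs_sum_le_sum_abs _ _
    _ = ∑ j ∈ Finset.Ico m (m + r), ∫ ω, |X j ω| ∂μ :=
        integral_finsetSum _ fun j _ ↦ (hX j).abs
    _ ≤ r * M := by
        simpa using Finset.sum_le_card_nsmul (Finset.Ico m (m + r)) _ M fun j _ ↦ hM j

variable [IsProbabilityMeasure μ]

theorem norm_charFun_partialSum_sub_pow_le {M C s : ℝ} {m : ℕ} (hX : ∀ n, Integrable (X n) μ)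
    (hM : ∀ n, ∫ ω, |X n ω| ∂μ ≤ M) (hm : 0 < m)
    (hsplit : ∀ N, ‖charFun (μ.map (partialSum X (N + m))) s -
      charFun (μ.map (partialSum X N)) s * charFun (μ.map (partialSum X m)) s‖ ≤ C) (n : ℕ) :
    ‖charFun (μ.map (partialSum X n)) s - charFun (μ.map (partialSum X m)) s ^ (n / m)‖ ≤
      |s| * (m * M) + (n / m : ℕ) * C := by
  have hprob (k : ℕ) : IsProbabilityMeasure (μ.map (partialSum X k)) :=
    Measure.isProbabilityMeasure_map (aemeasurable_partialSum (fun j ↦ (hX j).aemeasurable) k)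
  have hM0 : 0 ≤ M := (integral_nonneg fun ω ↦ abs_nonneg (X 0 ω)).trans (hM 0)
  have hzero : charFun (μ.map (partialSum X 0)) s = 1 := by
    simp [show partialSum X 0 = fun _ ↦ 0 from rfl]
  have hremainder : ‖charFun (μ.map (partialSum X n)) s -
      charFun (μ.map (partialSum X (n / m * m))) s‖ ≤ |s| * (m * M) := by
    have h := norm_charFun_partialSum_add_sub_le hX hM (n / m * m) (n % m) s
    rw [Nat.div_add_mod'] at h
    refine h.trans ?_
    gcongr
    exact (Nat.mod_lt n hm).le
  have hblocks := norm_sub_pow_le_of_norm_add_sub_mul_le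
    (a := fun N ↦ charFun (μ.map (partialSum X N)) s) hzero (norm_charFun_le_one s) hsplit (n / m)
  exact (norm_sub_le_norm_sub_add_norm_sub _ _ _).trans (add_le_add hremainder hblocks)

theorem tendsto_charFun_partialSum_div_sqrt_pow (hX : ∀ n, MemLp (X n) 2 μ)
    (hcent : ∀ n, μ[X n] = 0) (t : ℝ) (m : ℕ) :
    Tendsto (fun n : ℕ ↦ charFun (μ.map (partialSum X m)) (t / √n) ^ (n / m)) atTop
      (𝓝 (Complex.exp (-(t ^ 2 * (Var[partialSum X m; μ] / m) / 2 : ℝ)))) := by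
  have h0 := integral_partialSum_eq_zero (fun n ↦ (hX n).integrable one_le_two) hcent m
  have hks : Tendsto (fun n : ℕ ↦ ((n / m : ℕ) : ℝ) * (t / √n) ^ 2) atTop
      (𝓝 (t ^ 2 * (1 / m))) := by
    refine ((tendsto_natCast_div_natCast_div m).const_mul (t ^ 2)).congr fun n ↦ ?_
    rw [div_pow, Real.sq_sqrt n.cast_nonneg]
    ring
  convert tendsto_charFun_map_pow (memLp_partialSum hX m) h0 (tendsto_div_sqrt_natCast t) hks
    using 5
  ring

theorem tendsto_charFun_partialSum_div_sqrt {M v : ℝ} {δ : ℕ → ℝ} (hX : ∀ n, MemLp (X n) 2 μ)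
    (hcent : ∀ n, μ[X n] = 0) (hM : ∀ n, ∫ ω, |X n ω| ∂μ ≤ M)
    (hsplit : ∀ s N m, ‖charFun (μ.map (partialSum X (N + m))) s -
      charFun (μ.map (partialSum X N)) s * charFun (μ.map (partialSum X m)) s‖ ≤ s ^ 2 * δ m)
    (hδ : Tendsto (fun m ↦ δ m / m) atTop (𝓝 0))
    (hv : Tendsto (fun n ↦ Var[partialSum X n; μ] / n) atTop (𝓝 v)) (t : ℝ) :
    Tendsto (fun n : ℕ ↦ charFun (μ.map (partialSum X n)) (t / √n)) atTop
      (𝓝 (Complex.exp (-(t ^ 2 * v / 2 : ℝ)))) := by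
  have hδ0 (m : ℕ) : 0 ≤ δ m := by simpa using (norm_nonneg _).trans (hsplit 1 0 m)
  have hlimit : Continuous fun w : ℝ ↦ Complex.exp (-(t ^ 2 * w / 2 : ℝ)) := by fun_prop
  refine tendsto_of_eventually_dist_lt (p := atTop) (fun ε hε ↦ ?_)
    (.of_forall <| tendsto_charFun_partialSum_div_sqrt_pow hX hcent t)
    ((hlimit.tendsto v).comp hv)
  have hδt : Tendsto (fun m ↦ t ^ 2 * (δ m / m)) atTop (𝓝 0) := by simpa using hδ.const_mul (t ^ 2)
  filter_upwards [hδt.eventually_lt_const (half_pos hε), eventually_gt_atTop 0] with m hmε hm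
  have hremainder : Tendsto (fun n : ℕ ↦ |t / √n| * (m * M)) atTop (𝓝 0) := by
    simpa using (tendsto_div_sqrt_natCast t).abs.mul_const (m * M)
  filter_upwards [hremainder.eventually_lt_const (half_pos hε)] with n hn
  have hdist := norm_charFun_partialSum_sub_pow_le (fun n ↦ (hX n).integrable one_le_two) hM hm
    (fun N ↦ hsplit (t / √n) N m) n
  rw [dist_eq_norm]
  linarith [natCast_div_mul_div_sqrt_sq_mul_le (hδ0 m) t n m]

theorem tendstoInDistribution_partialSum_div_sqrt {M : ℝ} {v : ℝ≥0} {δ : ℕ → ℝ}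
    (hX : ∀ n, MemLp (X n) 2 μ) (hcent : ∀ n, μ[X n] = 0) (hM : ∀ n, ∫ ω, |X n ω| ∂μ ≤ M)
    (hsplit : ∀ s N m, ‖charFun (μ.map (partialSum X (N + m))) s -
      charFun (μ.map (partialSum X N)) s * charFun (μ.map (partialSum X m)) s‖ ≤ s ^ 2 * δ m)
    (hδ : Tendsto (fun m ↦ δ m / m) atTop (𝓝 0))
    (hv : Tendsto (fun n ↦ Var[partialSum X n; μ] / n) atTop (𝓝 (v : ℝ))) :
    TendstoInDistribution (fun (n : ℕ) ω ↦ (1 / √n) * partialSum X n ω) atTop (id : ℝ → ℝ)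
      (fun _ ↦ μ) (gaussianReal 0 v) := by
  have hmeas := aemeasurable_partialSum fun n ↦ (hX n).aemeasurable
  refine ⟨fun n ↦ (hmeas n).const_mul _, aemeasurable_id, ?_⟩
  refine ProbabilityMeasure.tendsto_iff_tendsto_charFun.2 fun t ↦ ?_
  have hchar := tendsto_charFun_partialSum_div_sqrt hX hcent hM hsplit hδ hv t
  simp only [ProbabilityMeasure.coe_mk, Measure.map_id, charFun_gaussianReal]
  convert hchar using 2 with n
  · rw [charFun_map_mul_comp (hmeas n), one_div_mul_eq_div]
  · congr 1
    push_cast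
    ring

end PartialSum

section Variance

variable {Ω : Type*} [MeasurableSpace Ω] {μ : Measure Ω} {X : ℕ → Ω → ℝ}

/-- The long-run variance of a sequence whose covariances `cov[X i, X (i + k)]` do not depend on
`i`: the sum of `cov[X 0, X k]` over all integers `k`, folded by symmetry to `k ≥ 1`. It is the
limit of `Var (S n) / n` if the series converges. -/
noncomputable def longRunVariance (μ : Measure Ω) (X : ℕ → Ω → ℝ) : ℝ :=
  Var[X 0; μ] + 2 * ∑' k, cov[X 0, X (k + 1); μ]

variable [IsFiniteMeasure μ]

theorem variance_partialSum_succ (hX : ∀ n, MemLp (X n) 2 μ)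
    (hcov : ∀ i k, cov[X i, X (i + k); μ] = cov[X 0, X k; μ]) (n : ℕ) :
    Var[partialSum X (n + 1); μ] = Var[partialSum X n; μ] +
      (Var[X 0; μ] + 2 * ∑ k ∈ Finset.range n, cov[X 0, X (k + 1); μ]) := by
  have hsucc : partialSum X (n + 1) = partialSum X n + X n :=
    funext fun _ ↦ Finset.sum_range_succ _ n
  have hvar : Var[X n; μ] = Var[X 0; μ] := by
    rw [← covariance_self (hX n).aemeasurable, ← covariance_self (hX 0).aemeasurable]
    exact hcov n 0
  have hcross : cov[partialSum X n, X n; μ] =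
      ∑ k ∈ Finset.range n, cov[X 0, X (k + 1); μ] := by
    unfold partialSum
    rw [covariance_fun_sum_left' (fun i _ ↦ hX i) (hX n), ← Finset.sum_range_reflect]
    refine Finset.sum_congr rfl fun k hk ↦ ?_
    rw [← hcov (n - 1 - k) (k + 1)]
    have := Finset.mem_range.1 hk
    congr
    omega
  rw [hsucc, variance_add (memLp_partialSum hX n) (hX n), hvar, hcross]
  ring

theorem variance_partialSum (hX : ∀ n, MemLp (X n) 2 μ)
    (hcov : ∀ i k, cov[X i, X (i + k); μ] = cov[X 0, X k; μ]) (n : ℕ) :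
    Var[partialSum X n; μ] = ∑ i ∈ Finset.range n,
      (Var[X 0; μ] + 2 * ∑ k ∈ Finset.range i, cov[X 0, X (k + 1); μ]) := by
  induction n with
  | zero => exact variance_zero μ
  | succ n ih => rw [variance_partialSum_succ hX hcov, ih, Finset.sum_range_succ]

theorem tendsto_variance_partialSum_div (hX : ∀ n, MemLp (X n) 2 μ)
    (hcov : ∀ i k, cov[X i, X (i + k); μ] = cov[X 0, X k; μ])
    (hsum : Summable fun k ↦ cov[X 0, X (k + 1); μ]) :
    Tendsto (fun n ↦ Var[partialSum X n; μ] / n) atTop (𝓝 (longRunVariance μ X)) := by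
  simpa only [variance_partialSum hX hcov, div_eq_inv_mul, longRunVariance] using
    ((hsum.hasSum.tendsto_sum_nat.const_mul 2).const_add Var[X 0; μ]).cesaro

end Variance

section Stationarity

variable {Ω : Type*} [MeasurableSpace Ω] {μ : Measure Ω} {X : ℕ → Ω → ℝ}

theorem IsStrictlyStationary.identDistrib_sum_Ico (h : IsStrictlyStationary μ X) (N m : ℕ) :
    IdentDistrib (fun ω ↦ ∑ j ∈ Finset.Ico N (N + m), X j ω) (partialSum X m) μ μ := by
  convert (h N (Finset.range m)).comp (u := fun x ↦ ∑ i, x i) (by fun_prop) using 1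
  · ext ω
    rw [Finset.sum_Ico_eq_sum_range, Nat.add_sub_cancel_left, Function.comp_apply,
      Finset.sum_coe_sort (Finset.range m) fun i ↦ X (i + N) ω]
    simp only [add_comm]
  · ext ω
    exact (Finset.sum_coe_sort (Finset.range m) fun i ↦ X i ω).symm

theorem IsStrictlyStationary.identDistrib (h : IsStrictlyStationary μ X) (n : ℕ) :
    IdentDistrib (X n) (X 0) μ μ := by
  simpa [Function.comp_def] using (h n {0}).comp (measurable_pi_apply ⟨0, by simp⟩)

theorem IsStrictlyStationary.covariance_add (h : IsStrictlyStationary μ X) (i k : ℕ) :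
    cov[X i, X (i + k); μ] = cov[X 0, X k; μ] := by
  have hpair := h i {0, k}
  have hcov {U : Ω → ({0, k} : Finset ℕ) → ℝ} (hU : AEMeasurable U μ) :
      cov[fun x ↦ x ⟨0, by simp⟩, fun x ↦ x ⟨k, by simp⟩; μ.map U] =
        cov[fun ω ↦ U ω ⟨0, by simp⟩, fun ω ↦ U ω ⟨k, by simp⟩; μ] :=
    covariance_map_fun (measurable_pi_apply _).aestronglyMeasurable
      (measurable_pi_apply _).aestronglyMeasurable hU
  have hshift : cov[X (0 + i), X (k + i); μ] = cov[X 0, X k; μ] := by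
    rw [← hcov hpair.aemeasurable_snd, ← hpair.map_eq]
    exact (hcov hpair.aemeasurable_fst).symm
  rwa [zero_add, add_comm k] at hshift

end Stationarity

section LipNorm

variable {ι : Type*} [Fintype ι]

theorem lipNorm_nonneg (f : (ι → ℝ) → ℝ) : 0 ≤ lipNorm f := by
  refine Real.sSup_nonneg ?_
  rintro _ ⟨x, y, -, rfl⟩
  positivity

theorem lipNorm_le {f : (ι → ℝ) → ℝ} {K : ℝ} (hK : 0 ≤ K)
    (hf : ∀ x y, |f x - f y| ≤ K * ∑ i, |x i - y i|) : lipNorm f ≤ K := by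
  refine Real.sSup_le ?_ hK
  rintro _ ⟨x, y, -, rfl⟩
  exact div_le_of_le_mul₀ (by positivity) hK (hf x y)

theorem abs_comp_sum_sub_comp_sum_le {u : ℝ → ℝ} {K : ℝ≥0} (hu : LipschitzWith K u)
    (x y : ι → ℝ) : |u (∑ i, x i) - u (∑ i, y i)| ≤ K * ∑ i, |x i - y i| := by
  refine (hu.dist_le_mul _ _).trans ?_
  rw [Real.dist_eq, ← Finset.sum_sub_distrib]
  gcongr
  exact Finset.abs_sum_le_sum_abs _ _

theorem isLip_comp_sum {u : ℝ → ℝ} {K : ℝ≥0} (hu : LipschitzWith K u) :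
    IsLip fun x : ι → ℝ ↦ u (∑ i, x i) :=
  ⟨K, abs_comp_sum_sub_comp_sum_le hu⟩

theorem lipNorm_comp_sum_le {u : ℝ → ℝ} {K : ℝ≥0} (hu : LipschitzWith K u) :
    lipNorm (fun x : ι → ℝ ↦ u (∑ i, x i)) ≤ K :=
  lipNorm_le K.2 (abs_comp_sum_sub_comp_sum_le hu)

end LipNorm

section WeakDependence

variable {Ω : Type*} [MeasurableSpace Ω] {μ : Measure Ω} {X : ℕ → Ω → ℝ} {γ : ℕ → ℝ}

/-- The coefficients `γ` witness the covariance inequality of L-weak dependence. Their summability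
is not part of the notion. -/
structure IsCovarianceBound (μ : Measure Ω) (X : ℕ → Ω → ℝ) (γ : ℕ → ℝ) : Prop where
  nonneg : ∀ k, 0 ≤ γ k
  abs_covariance_le : ∀ I J : Finset ℕ, Disjoint I J →
    ∀ (f : (I → ℝ) → ℝ) (g : (J → ℝ) → ℝ), IsLip f → IsLip g →
      |cov[fun ω ↦ f (fun i ↦ X i ω), fun ω ↦ g (fun j ↦ X j ω); μ]| ≤
        lipNorm f * lipNorm g * ∑ i ∈ I, ∑ j ∈ J, γ ((j : ℤ) - (i : ℤ)).natAbs

theorem IsCovarianceBound.abs_covariance_comp_sum_le (hγ : IsCovarianceBound μ X γ)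
    {I J : Finset ℕ} (hIJ : Disjoint I J) {u v : ℝ → ℝ} {K L : ℝ≥0} (hu : LipschitzWith K u)
    (hv : LipschitzWith L v) :
    |cov[fun ω ↦ u (∑ i ∈ I, X i ω), fun ω ↦ v (∑ j ∈ J, X j ω); μ]| ≤
      K * L * ∑ i ∈ I, ∑ j ∈ J, γ ((j : ℤ) - (i : ℤ)).natAbs := by
  have hcov := hγ.abs_covariance_le I J hIJ _ _ (isLip_comp_sum hu) (isLip_comp_sum hv)
  have hsum (S : Finset ℕ) (ω : Ω) : ∑ i : S, X i ω = ∑ i ∈ S, X i ω :=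
    Finset.sum_coe_sort S fun i ↦ X i ω
  simp only [hsum] at hcov
  refine hcov.trans ?_
  have hnonneg : 0 ≤ ∑ i ∈ I, ∑ j ∈ J, γ ((j : ℤ) - (i : ℤ)).natAbs :=
    Finset.sum_nonneg fun _ _ ↦ Finset.sum_nonneg fun _ _ ↦ hγ.nonneg _
  gcongr
  · exact lipNorm_nonneg _
  · exact lipNorm_comp_sum_le hu
  · exact lipNorm_comp_sum_le hv

theorem IsCovarianceBound.abs_covariance_le_of_ne (hγ : IsCovarianceBound μ X γ) {i j : ℕ}
    (hij : i ≠ j) : |cov[X i, X j; μ]| ≤ γ ((j : ℤ) - (i : ℤ)).natAbs := by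
  simpa using hγ.abs_covariance_comp_sum_le (Finset.disjoint_singleton.2 hij) LipschitzWith.id
    LipschitzWith.id

theorem IsCovarianceBound.summable_covariance (hγ : IsCovarianceBound μ X γ)
    (hs : Summable γ) : Summable fun k ↦ cov[X 0, X (k + 1); μ] :=
  .of_norm_bounded ((summable_nat_add_iff 1).2 hs) fun k ↦
    hγ.abs_covariance_le_of_ne k.succ_ne_zero.symm

theorem IsCovarianceBound.norm_charFun_map_add_sub_mul_le [IsProbabilityMeasure μ]
    (hγ : IsCovarianceBound μ X γ) (hX : ∀ n, AEMeasurable (X n) μ) {I J : Finset ℕ}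
    (hIJ : Disjoint I J) (s : ℝ) :
    ‖charFun (μ.map fun ω ↦ ∑ i ∈ I, X i ω + ∑ j ∈ J, X j ω) s -
      charFun (μ.map fun ω ↦ ∑ i ∈ I, X i ω) s * charFun (μ.map fun ω ↦ ∑ j ∈ J, X j ω) s‖ ≤
      4 * (s ^ 2 * ∑ i ∈ I, ∑ j ∈ J, γ ((j : ℤ) - (i : ℤ)).natAbs) := by
  have hmeas (S : Finset ℕ) : AEMeasurable (fun ω ↦ ∑ i ∈ S, X i ω) μ :=
    Finset.aemeasurable_fun_sum _ fun i _ ↦ hX i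
  have hcos : LipschitzWith ‖s‖₊ fun x ↦ Real.cos (s * x) := by
    simpa [Function.comp_def] using Real.lipschitzWith_cos.comp (lipschitzWith_smul s)
  have hsin : LipschitzWith ‖s‖₊ fun x ↦ Real.sin (s * x) := by
    simpa [Function.comp_def] using Real.lipschitzWith_sin.comp (lipschitzWith_smul s)
  have hcov {u v : ℝ → ℝ} (hu : LipschitzWith ‖s‖₊ u) (hv : LipschitzWith ‖s‖₊ v) :
      ‖cov[fun ω ↦ u (∑ i ∈ I, X i ω), fun ω ↦ v (∑ j ∈ J, X j ω); μ]‖ ≤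
        s ^ 2 * ∑ i ∈ I, ∑ j ∈ J, γ ((j : ℤ) - (i : ℤ)).natAbs := by
    simpa [← sq] using hγ.abs_covariance_comp_sum_le hIJ hu hv
  rw [charFun_map_add_sub_mul (hmeas I) (hmeas J)]
  refine (norm_add_le _ _).trans ?_
  rw [norm_mul, Complex.norm_I, mul_one, Complex.norm_real, Complex.norm_real]
  have hre := norm_sub_le_of_le (hcov hcos hcos) (hcov hsin hsin)
  have him := norm_add_le_of_le (hcov hcos hsin) (hcov hsin hcos)
  linarith

/-- The sum of the coefficients `γ |j - i|` over all `j` in a block of `m` consecutive integers and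
all integers `i` preceding the block: `k + (j + 1)` runs over the distances from the `j`-th
element of the block (counted from `0`) to those integers. It is only meaningful for summable `γ`,
because `∑'` is `0` on divergent series. -/
noncomputable def blockDependence (γ : ℕ → ℝ) (m : ℕ) : ℝ :=
  ∑ j ∈ Finset.range m, ∑' k, γ (k + (j + 1))

theorem sum_range_sum_Ico_le_blockDependence (hγ0 : ∀ k, 0 ≤ γ k) (hs : Summable γ) (N m : ℕ) :
    ∑ i ∈ Finset.range N, ∑ j ∈ Finset.Ico N (N + m), γ ((j : ℤ) - (i : ℤ)).natAbs ≤
      blockDependence γ m := by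
  rw [Finset.sum_comm, Finset.sum_Ico_eq_sum_range, Nat.add_sub_cancel_left]
  refine Finset.sum_le_sum fun j _ ↦ ?_
  calc ∑ i ∈ Finset.range N, γ (((N + j : ℕ) : ℤ) - (i : ℤ)).natAbs
      = ∑ k ∈ Finset.range N, γ (k + (j + 1)) := by
        rw [← Finset.sum_range_reflect]
        refine Finset.sum_congr rfl fun k hk ↦ ?_
        have := Finset.mem_range.1 hk
        congr 1
        omega
    _ ≤ ∑' k, γ (k + (j + 1)) :=
        ((summable_nat_add_iff (j + 1)).2 hs).sum_le_tsum _ fun _ _ ↦ hγ0 _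

theorem tendsto_blockDependence_div (γ : ℕ → ℝ) :
    Tendsto (fun m ↦ blockDependence γ m / m) atTop (𝓝 0) := by
  simpa only [blockDependence, div_eq_inv_mul, Function.comp_apply] using
    ((tendsto_sum_nat_add γ).comp (tendsto_add_atTop_nat 1)).cesaro

theorem IsCovarianceBound.norm_charFun_partialSum_add_sub_mul_le [IsProbabilityMeasure μ]
    (hγ : IsCovarianceBound μ X γ) (hs : Summable γ) (hX : ∀ n, AEMeasurable (X n) μ)
    (hstat : IsStrictlyStationary μ X) (s : ℝ) (N m : ℕ) :
    ‖charFun (μ.map (partialSum X (N + m))) s -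
      charFun (μ.map (partialSum X N)) s * charFun (μ.map (partialSum X m)) s‖ ≤
      s ^ 2 * (4 * blockDependence γ m) := by
  have hdisj : Disjoint (Finset.range N) (Finset.Ico N (N + m)) := by
    rw [Finset.range_eq_Ico]
    exact Finset.Ico_disjoint_Ico_consecutive _ _ _
  rw [partialSum_add, ← (hstat.identDistrib_sum_Ico N m).map_eq]
  refine (hγ.norm_charFun_map_add_sub_mul_le hX hdisj s).trans ?_
  rw [mul_left_comm]
  gcongr
  exact sum_range_sum_Ico_le_blockDependence hγ.nonneg hs N m

end WeakDependence

theorem mainTheorem4 {Ω : Type*} [MeasurableSpace Ω] (μ : Measure Ω) [IsProbabilityMeasure μ]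
    (X : ℕ → Ω → ℝ)
    (hsq : ∀ n, MemLp (X n) 2 μ)
    (hcent : ∀ n, ∫ ω, X n ω ∂μ = 0)
    (hstat : IsStrictlyStationary μ X)
    (hdep : IsLWeaklyDependent μ X) :
    ∃ σ2 : ℝ≥0,
      Tendsto (fun n : ℕ ↦ (1 / (n : ℝ)) * ∫ ω, (partialSum X n ω) ^ 2 ∂μ) atTop (𝓝 (σ2 : ℝ)) ∧
      TendstoInDistribution (fun (n : ℕ) (ω : Ω) ↦ (1 / Real.sqrt (n : ℝ)) * partialSum X n ω)
        atTop (id : ℝ → ℝ) (fun _ ↦ μ) (gaussianReal 0 σ2) := by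
  obtain ⟨γ, hγ0, hγs, hcov⟩ := hdep
  have hγ : IsCovarianceBound μ X γ := ⟨hγ0, hcov⟩
  have hvar : Tendsto (fun n ↦ Var[partialSum X n; μ] / n) atTop (𝓝 (longRunVariance μ X)) :=
    tendsto_variance_partialSum_div hsq hstat.covariance_add (hγ.summable_covariance hγs)
  have hσ2 : 0 ≤ longRunVariance μ X := ge_of_tendsto' hvar fun n ↦
    div_nonneg (variance_nonneg _ _) n.cast_nonneg
  have hsecond (n : ℕ) : Var[partialSum X n; μ] = ∫ ω, (partialSum X n ω) ^ 2 ∂μ :=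
    variance_of_integral_eq_zero (memLp_partialSum hsq n).aemeasurable
      (integral_partialSum_eq_zero (fun k ↦ (hsq k).integrable one_le_two) hcent n)
  have hfirst (n : ℕ) : ∫ ω, |X n ω| ∂μ ≤ ∫ ω, |X 0 ω| ∂μ :=
    ((hstat.identDistrib n).comp measurable_norm).integral_eq.le
  have hsplit := hγ.norm_charFun_partialSum_add_sub_mul_le hγs
    (fun n ↦ (hsq n).aemeasurable) hstat
  have hδ : Tendsto (fun m ↦ 4 * blockDependence γ m / m) atTop (𝓝 0) := by
    simpa [mul_div_assoc] using (tendsto_blockDependence_div γ).const_mul 4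
  refine ⟨⟨longRunVariance μ X, hσ2⟩, ?_,
    tendstoInDistribution_partialSum_div_sqrt hsq hcent hfirst hsplit hδ hvar⟩
  exact hvar.congr fun n ↦ by rw [hsecond, one_div_mul_eq_div]
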